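/- **Setting (Domination).** An instance $C=(n,\mathbf p,\mathbf q)$ of Domination consists of vectors $\mathbf p,\mathbf q\in[0,1]^n$ with $p_i\ge q_i$ for all $i$. A fair bit $B$ is drawn. Independent samples $X_{i,j},Y_{i,j}\in\{0,1\}$ ($i\in[n]$, $j\in[r]$) are generated, with $X_{i,j}\sim\mathrm{Bern}(p_i)$, $Y_{i,j}\sim\mathrm{Bern}(q_i)$ if $B=0$, and with the roles of $\mathbf p,\mathbf q$ exchanged if $B=1$. A (randomized) algorithm sees only the samples and succeeds if it outputs $B$. Put $S_i=\sum_{j=1}^r(X_{i,j}-Y_{i,j})$. The algorithm $\mathcal A_{count}$ takes $Z=\sum_iS_i$, and $\mathcal A_{max}$ takes $Z=S_{i'}$ where $i'$ maximizes $|S_i|$ (ties broken arbitrarily); each outputs $0$ if $Z>0$, $1$ if $Z<0$, and a fair coin if $Z=0$. **Setting (Top-K).** An instance $S=(n,k,\mathbf P)$ of Top-K consists of $k\le n$ and a matrix $\mathbf P\in[0,1]^{n\times n}$ with $P_{v,u}=1-P_{u,v}$ for all $u,v$ and $P_{u,l}\ge P_{v,l}$ for all $u<v$ and all $l$. A uniformly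 random permutation $\pi$ of $[n]$ is drawn, and the algorithm sees $n,k,r$ and independent samples $X_{i,j,l}\sim\mathrm{Bern}(P_{\pi^{-1}(i),\pi^{-1}(j)})$, $i,j\in[n]$, $l\in[r]$. It succeeds if it outputs $\{\pi(1),\dots,\pi(k)\}$. The Shah–Wainwright counting algorithm $A'$ outputs the $k$ items $i$ with the largest number of wins $\sum_{j,l}X_{i,j,l}$, ties broken arbitrarily. **Sample complexity.** For an instance $I$ of either problem, $r_{min}(I,A,p)$ is the least $r_0\in\mathbb N$ such that for all $r\ge r_0$ algorithm $A$ succeeds on $I$ with probability at least $p$ when given $r$ samples ($\infty$ if there is none). Write $r_{min}(I,A)=r_{min}(I,A,\tfrac34)$ and $r_{min}(I)=\inf_A r_{min}(I,A)$, over all (randomized) algorithms. A Top-K algorithm $A$ is $f$-competitive on $n$ items, where $f\ge 0$ is real, if $r_{min}(S,A)\le f\cdot r_{min}(S)$ for all instances $S$ with $n$ items. **Statement.** 1. There is $n_0$ such that for all $n\ge n_0$ and all $0<\varepsilon<\frac1{10}$ there is an instance $C=(n,\mathbf p,\mathbf q)$ of Domination with $$r_{min}\bigl(C,\mathcal A_{max},1-\tfrac2n\bigr)\le\frac{16\ln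 n}{\varepsilon^2}\qquad\text{and}\qquad r_{min}(C,\mathcal A_{count})\ge\frac{n}{128\,\varepsilon^2}.$$ 2. There are absolute constants $c,K>0$ and $n_0$ such that the following holds for all $n\ge n_0$, $0<\varepsilon<\frac1{10}$ and $1\le k<n$. Let $S=(n,k,\mathbf P)$, where $P_{u,v}=\frac12+\varepsilon$ for $u<v$, $P_{u,u}=\frac12$, and $P_{u,v}=\frac12-\varepsilon$ for $u>v$. Then $$r_{min}(S)\le K\,\frac{\ln n}{\varepsilon^2},\qquad r_{min}(S,A')\ge c\,\frac{n}{\varepsilon^2},\qquad r_{min}(S,A')\ge c\,\frac{n}{\ln n}\,r_{min}(S).$$ 3. Consequently the counting algorithm $A'$ for Top-K has competitive ratio $\tilde\Omega(n)$: there are absolute constants $c>0$ and $n_0$ such that for all $n\ge n_0$, if $A'$ is $f$-competitive on $n$ items, then $f\ge c\,n/\ln n$. -/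

import Mathlib

open MeasureTheory ProbabilityTheory
open scoped ENNReal NNReal

noncomputable section

namespace NoisyTopK

/-- A single comparison: `true` (the value one) with probability `z`, `false` otherwise. -/
def coin (z : unitInterval) : Measure Bool := bernoulliMeasure true false z

/-- The sample complexity belonging to a success curve `succ` (`succ r` is the probability of
success with `r` samples): the least number `r₀` such that the success probability is at least `p`
for all `r ≥ r₀`, and `∞` if there is no such number. -/
def rMin (succ : ℕ → ℝ) (p : ℝ) : ℝ≥0∞ :=
  ⨅ (r₀ : ℕ) (_ : ∀ r : ℕ, r₀ ≤ r → p ≤ succ r), (r₀ : ℝ≥0∞)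

/-! ### The problem Domination -/

/-- An instance `(n, p, q)` of Domination. -/
structure DominationInstance (n : ℕ) where
  p : Fin n → unitInterval
  q : Fin n → unitInterval
  le : ∀ i, q i ≤ p i

/-- A table of samples: `r` bits for each of `n` coordinates. -/
abbrev Table (n r : ℕ) : Type := Fin n → Fin r → Bool

/-- A randomized algorithm for Domination: it sees `n`, `r` and the samples `X`, `Y`, and outputs
a random bit (`false` is the bit `0`, `true` is the bit `1`). -/
abbrev DominationAlgorithm : Type := ∀ n r : ℕ, Table n r → Table n r → PMF Bool

/-- The law of a table of independent samples, row `i` having mean `p i`. -/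
def tableLaw {n : ℕ} (p : Fin n → unitInterval) (r : ℕ) : Measure (Table n r) :=
  Measure.pi fun i => Measure.pi fun _ => coin (p i)

/-- The law of the samples `(X, Y)` given the hidden bit `b`. -/
def DominationInstance.sampleLaw {n : ℕ} (C : DominationInstance n) (r : ℕ) (b : Bool) :
    Measure (Table n r × Table n r) :=
  if b = false then (tableLaw C.p r).prod (tableLaw C.q r)
  else (tableLaw C.q r).prod (tableLaw C.p r)

/-- The probability that `A` outputs the hidden bit, which is a fair coin, given `r` samples. -/
def DominationInstance.successProb {n : ℕ} (C : DominationInstance n) (A : DominationAlgorithm)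
    (r : ℕ) : ℝ :=
  (1 / 2 : ℝ) * ∑ b : Bool, ∫ s, (A n r s.1 s.2 b).toReal ∂(C.sampleLaw r b)

/-- `r_min(C, A, p)`. -/
def DominationInstance.rMin {n : ℕ} (C : DominationInstance n) (A : DominationAlgorithm)
    (p : ℝ) : ℝ≥0∞ :=
  NoisyTopK.rMin (C.successProb A) p

/-- `S_i = ∑_j (X_{i,j} - Y_{i,j})`. -/
def score {n r : ℕ} (X Y : Table n r) (i : Fin n) : ℤ :=
  ∑ j, (((X i j).toNat : ℤ) - ((Y i j).toNat : ℤ))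

/-- Output `0` if `Z > 0`, output `1` if `Z < 0`, and output a fair coin if `Z = 0`. -/
def signDecision (Z : ℤ) : PMF Bool :=
  if 0 < Z then PMF.pure false
  else if Z < 0 then PMF.pure true
  else PMF.uniformOfFintype Bool

/-- The counting algorithm for Domination: decide by the sign of `∑_i S_i`. -/
def countAlgorithm : DominationAlgorithm :=
  fun _ _ X Y => signDecision (∑ i, score X Y i)

/-- `A` is a version of the max algorithm for Domination: decide by the sign of `S_{i'}`, where
`i'` maximizes `|S_i|`. If there are several maximizers, `i'` may be any of them, chosen by any
(possibly random) rule. -/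
def IsMaxAlgorithm (A : DominationAlgorithm) : Prop :=
  ∀ n r : ℕ, 0 < n → ∀ X Y : Table n r, ∃ choice : PMF (Fin n),
    (∀ i ∈ choice.support, ∀ j, |score X Y j| ≤ |score X Y i|) ∧
    A n r X Y = choice.bind fun i => signDecision (score X Y i)

/-! ### The problem Top-K -/

/-- Strong stochastic transitivity, with rank `0` the best. -/
structure IsSST {n : ℕ} (P : Fin n → Fin n → unitInterval) : Prop where
  mono : ∀ u v, u < v → ∀ l, P v l ≤ P u l
  skew : ∀ u v, (P v u : ℝ) = 1 - (P u v : ℝ)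

/-- An instance `(n, k, P)` of Top-K. -/
structure TopKInstance (n : ℕ) where
  k : ℕ
  k_le : k ≤ n
  P : Fin n → Fin n → unitInterval
  sst : IsSST P

/-- The outcomes `X i j l` of `r` comparisons for every pair `(i, j)` of items; `X i j l = true`
means that `i` is preferred to `j` in the `l`-th one. -/
abbrev Comparisons (n r : ℕ) : Type := Fin n → Fin n → Fin r → Bool

/-- A randomized algorithm for Top-K: it sees `n`, `k`, `r` and the comparisons, and outputs a
random set of labels. -/
abbrev TopKAlgorithm : Type :=
  ∀ n _k r : ℕ, Comparisons n r → PMF (Finset (Fin n))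

/-- The law of the comparisons when `π u` is the label of the item of rank `u`. -/
def TopKInstance.sampleLaw {n : ℕ} (S : TopKInstance n) (π : Equiv.Perm (Fin n)) (r : ℕ) :
    Measure (Comparisons n r) :=
  Measure.pi fun i => Measure.pi fun j => Measure.pi fun _ =>
    coin (S.P (π.symm i) (π.symm j))

/-- The set of labels of the best `k` items. -/
def topSet {n : ℕ} (π : Equiv.Perm (Fin n)) (k : ℕ) : Finset (Fin n) :=
  Finset.univ.filter fun i => (π.symm i : ℕ) < k

/-- The probability that `A` outputs the set of the best `k` items given `r` samples, the
permutation `π` being uniformly random. -/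
def TopKInstance.successProb {n : ℕ} (S : TopKInstance n) (A : TopKAlgorithm) (r : ℕ) : ℝ :=
  (∑ π : Equiv.Perm (Fin n), ∫ X, (A n S.k r X (topSet π S.k)).toReal ∂(S.sampleLaw π r)) /
    (n.factorial : ℝ)

/-- `r_min(S, A, p)`. -/
def TopKInstance.rMin {n : ℕ} (S : TopKInstance n) (A : TopKAlgorithm) (p : ℝ) : ℝ≥0∞ :=
  NoisyTopK.rMin (S.successProb A) p

/-- `r_min(S, p)`, the infimum of `r_min(S, A, p)` over all algorithms. -/
def TopKInstance.rMinOpt {n : ℕ} (S : TopKInstance n) (p : ℝ) : ℝ≥0∞ :=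
  ⨅ A : TopKAlgorithm, S.rMin A p

/-- The number of comparisons won by item `i`. -/
def wins {n r : ℕ} (X : Comparisons n r) (i : Fin n) : ℕ :=
  ∑ j, ∑ l, (X i j l).toNat

/-- `A` is a version of the Shah-Wainwright counting algorithm for Top-K: order the items by
decreasing number of comparisons won and output the first `k` of them, ties being broken by any
(possibly random) rule. -/
def IsCountingAlgorithm (A : TopKAlgorithm) : Prop :=
  ∀ n k r : ℕ, k ≤ n → ∀ X : Comparisons n r, ∀ T ∈ (A n k r X).support,
    T.card = k ∧ ∀ i ∈ T, ∀ j ∉ T, wins X j ≤ wins X i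

/-- `A` is `f`-competitive on the instances with `n` items. -/
def IsCompetitive (A : TopKAlgorithm) (n : ℕ) (f : ℝ≥0) : Prop :=
  ∀ S : TopKInstance n, S.rMin A (3 / 4) ≤ (f : ℝ≥0∞) * S.rMinOpt (3 / 4)

/-- The matrix with `1/2` on, `1/2 + ε` above and `1/2 - ε` below the diagonal. -/
def gapMatrix (n : ℕ) (ε : ℝ) (h₀ : 0 ≤ ε) (h₁ : ε ≤ 1 / 2) (u v : Fin n) : unitInterval :=
  if u < v then ⟨1 / 2 + ε, by constructor <;> linarith⟩
  else if v < u then ⟨1 / 2 - ε, by constructor <;> linarith⟩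
  else ⟨1 / 2, by constructor <;> norm_num⟩

theorem gapMatrix_isSST (n : ℕ) (ε : ℝ) (h₀ : 0 ≤ ε) (h₁ : ε ≤ 1 / 2) :
    IsSST (gapMatrix n ε h₀ h₁) where
  mono u v huv l := by
    rw [← Subtype.coe_le_coe]
    unfold gapMatrix
    split_ifs <;> first | omega | (simp only; linarith)
  skew u v := by
    unfold gapMatrix
    split_ifs <;> first | omega | (simp only; ring)

/-- The Top-K instance `(n, k, P)` with `P` the matrix `gapMatrix`. -/
def gapInstance (n k : ℕ) (hk : k ≤ n) (ε : ℝ) (h₀ : 0 ≤ ε) (h₁ : ε ≤ 1 / 2) :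
    TopKInstance n where
  k := k
  k_le := hk
  P := gapMatrix n ε h₀ h₁
  sst := gapMatrix_isSST n ε h₀ h₁

end NoisyTopK

end

noncomputable section

namespace NoisyTopK

/-! Counting adds the one or two informative coordinates to about `n` uninformative ones. With total
gap `Δ` the signal is of order `r * Δ`, while the remaining coordinates contribute symmetric noise
of order `√(n * r)`. The sign is therefore unreliable until `r` is of order `n / Δ ^ 2`. Rules that
look at coordinates separately need only a union bound over Chernoff estimates, hence `log n / ε ^
2` samples.

The lower bound is `one_fourth_lt_measureReal_score_neg`. It needs the noise to fall below minus
twice the signal with probability close to `1/2`. This follows from symmetry of the noise together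
with an atom bound `1 / √M` for a score with `M` sample pairs, obtained by Fourier inversion from a
Gaussian bound on the characteristic function. Chernoff's bound keeps the informative coordinates
from compensating.

For Top-K, the win difference of the items of ranks `k - 1` and `k` (counted from `0`) is a
Domination score formed from two independent rows. These rows differ in mean only in the two columns
of the items themselves, by `ε` each, so the same lemma applies with `Δ = 2 * ε`. Whenever that
score is negative, every version of counting errs. Majority votes on all pairs provide the matching
upper bound on the optimum. -/

/-! ### Exponential moments of scores -/

instance coin.instIsProbabilityMeasure (z : unitInterval) : IsProbabilityMeasure (coin z) := by
  unfold coin; infer_instance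

instance tableLaw.instIsProbabilityMeasure {n : ℕ} (p : Fin n → unitInterval) (r : ℕ) :
    IsProbabilityMeasure (tableLaw p r) := by
  unfold tableLaw; infer_instance

theorem integral_coin {E : Type*} [NormedAddCommGroup E] [NormedSpace ℝ E] [CompleteSpace E]
    (z : unitInterval) (f : Bool → E) :
    ∫ b, f b ∂(coin z) = (z : ℝ) • f true + (1 - (z : ℝ)) • f false := by
  rw [integral_fintype (Integrable.of_finite)]
  simp [coin]

theorem integral_tableLaw_prod {𝕜 : Type*} [RCLike 𝕜] {n r : ℕ} (p : Fin n → unitInterval)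
    (f : Fin n → Bool → 𝕜) :
    ∫ X, ∏ i, ∏ j, f i (X i j) ∂(tableLaw p r) = ∏ i, (∫ b, f i b ∂(coin (p i))) ^ r := by
  unfold tableLaw
  rw [integral_fintype_prod_eq_prod (fun i (x : Fin r → Bool) => ∏ j, f i (x j))]
  refine Finset.prod_congr rfl fun i _ => ?_
  rw [integral_fintype_prod_eq_pow, Fintype.card_fin]

theorem integral_prod_tableLaw_prod {𝕜 : Type*} [RCLike 𝕜] {n r : ℕ}
    (p q : Fin n → unitInterval) (f g : Fin n → Bool → 𝕜) :
    ∫ s, ∏ i, ∏ j, (f i (s.1 i j) * g i (s.2 i j)) ∂((tableLaw p r).prod (tableLaw q r)) =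
      ∏ i, ((∫ b, f i b ∂(coin (p i))) * ∫ b, g i b ∂(coin (q i))) ^ r := by
  simp_rw [Finset.prod_mul_distrib]
  rw [integral_prod_mul (fun X : Table n r => ∏ i, ∏ j, f i (X i j))
    (fun X : Table n r => ∏ i, ∏ j, g i (X i j)), integral_tableLaw_prod, integral_tableLaw_prod,
    ← Finset.prod_mul_distrib]
  simp_rw [mul_pow]

/-- The total score of the coordinates in `s`. -/
def scoreOn {n r : ℕ} (s : Finset (Fin n)) (ω : Table n r × Table n r) : ℤ :=
  ∑ i ∈ s, score ω.1 ω.2 i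

/-- The factors equal to `1` outside `s` let the product run over all coordinates, as independence
of the full tables requires. -/
theorem cexp_mul_scoreOn {n r : ℕ} (s : Finset (Fin n)) (z : ℂ) (ω : Table n r × Table n r) :
    Complex.exp (z * (scoreOn s ω : ℂ)) =
      ∏ i, ∏ j, ((if i ∈ s then Complex.exp (z * ((ω.1 i j).toNat : ℂ)) else 1) *
        (if i ∈ s then Complex.exp (-z * ((ω.2 i j).toNat : ℂ)) else 1)) := by
  have h : ∀ i : Fin n, (∏ j, ((if i ∈ s then Complex.exp (z * ((ω.1 i j).toNat : ℂ)) else 1) *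
        (if i ∈ s then Complex.exp (-z * ((ω.2 i j).toNat : ℂ)) else 1))) =
        if i ∈ s then Complex.exp (z * (score ω.1 ω.2 i : ℂ)) else 1 := by
    intro i
    split_ifs
    · simp_rw [← Complex.exp_add]
      rw [← Complex.exp_sum, score]
      congr 1
      push_cast
      rw [Finset.mul_sum]
      exact Finset.sum_congr rfl fun j _ => by ring
    · simp
  rw [Finset.prod_congr rfl fun i _ => h i, Finset.prod_ite_mem, Finset.univ_inter,
    ← Complex.exp_sum, scoreOn]
  congr 1
  push_cast
  rw [Finset.mul_sum]

/-- A complex `z` serves twice: real values give the Chernoff bounds, imaginary values the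
characteristic function. -/
theorem integral_cexp_mul_scoreOn {n r : ℕ} (s : Finset (Fin n)) (p q : Fin n → unitInterval)
    (z : ℂ) :
    ∫ ω, Complex.exp (z * (scoreOn s ω : ℂ)) ∂((tableLaw p r).prod (tableLaw q r)) =
      ∏ i ∈ s, (((p i : ℝ) * Complex.exp z + (1 - (p i : ℝ))) *
        ((q i : ℝ) * Complex.exp (-z) + (1 - (q i : ℝ)))) ^ r := by
  simp_rw [cexp_mul_scoreOn]
  rw [integral_prod_tableLaw_prod p q
    (fun i b => if i ∈ s then Complex.exp (z * (b.toNat : ℂ)) else 1)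
    (fun i b => if i ∈ s then Complex.exp (-z * (b.toNat : ℂ)) else 1)]
  simp_rw [integral_coin]
  rw [← Finset.univ_inter s, ← Finset.prod_ite_mem]
  refine Finset.prod_congr rfl fun i _ => ?_
  by_cases h : i ∈ s
  · simp [h]
  · simp [h]

theorem integral_exp_mul_scoreOn {n r : ℕ} (s : Finset (Fin n)) (p q : Fin n → unitInterval)
    (t : ℝ) :
    ∫ ω, Real.exp (t * (scoreOn s ω : ℝ)) ∂((tableLaw p r).prod (tableLaw q r)) =
      ∏ i ∈ s, (((p i : ℝ) * Real.exp t + (1 - (p i : ℝ))) *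
        ((q i : ℝ) * Real.exp (-t) + (1 - (q i : ℝ)))) ^ r := by
  have h := integral_cexp_mul_scoreOn (r := r) s p q (t : ℂ)
  apply Complex.ofReal_injective
  rw [← integral_complex_ofReal]
  push_cast
  exact h

/-! ### Chernoff bounds -/

/-- Hoeffding's lemma for a Bernoulli variable. -/
theorem coin_mgf_le (p : unitInterval) (t : ℝ) :
    (p : ℝ) * Real.exp t + (1 - (p : ℝ)) ≤ Real.exp (p * t + t ^ 2 / 8) := by
  have h := (hasSubgaussianMGF_of_mem_Icc (μ := coin p) (X := fun b : Bool => (b.toNat : ℝ))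
    (a := 0) (b := 1) (Measurable.of_discrete.aemeasurable)
    (Filter.Eventually.of_forall fun b => by cases b <;> simp)).mgf_le t
  simp only [mgf, integral_coin] at h
  simp at h
  have e : Real.exp (p * t + t ^ 2 / 8) = Real.exp (p * t) * Real.exp ((2 ^ 2)⁻¹ * t ^ 2 / 2) := by
    rw [← Real.exp_add]; congr 1; ring
  rw [e]
  calc (p : ℝ) * Real.exp t + (1 - (p : ℝ))
      = Real.exp (p * t) * (p * Real.exp (t * (1 - p)) + (1 - p) * Real.exp (-(t * p))) := by
        rw [mul_add, mul_left_comm, ← Real.exp_add, mul_left_comm, ← Real.exp_add]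
        ring_nf
        simp only [Real.exp_zero]
        ring
    _ ≤ _ := mul_le_mul_of_nonneg_left h (Real.exp_pos _).le

theorem integral_exp_mul_scoreOn_le {n r : ℕ} (s : Finset (Fin n)) (p q : Fin n → unitInterval)
    (t : ℝ) :
    ∫ ω, Real.exp (t * (scoreOn s ω : ℝ)) ∂((tableLaw p r).prod (tableLaw q r)) ≤
      Real.exp (r * ((∑ i ∈ s, ((p i : ℝ) - q i)) * t + s.card * (t ^ 2 / 4))) := by
  rw [integral_exp_mul_scoreOn, Finset.sum_mul, ← nsmul_eq_mul s.card, ← Finset.sum_const,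
    ← Finset.sum_add_distrib, ← nsmul_eq_mul, Finset.smul_sum, Real.exp_sum]
  have h0 : ∀ (x : unitInterval) (u : ℝ), 0 ≤ (x : ℝ) * Real.exp u + (1 - (x : ℝ)) := fun x u =>
    add_nonneg (mul_nonneg x.2.1 (Real.exp_pos _).le) (sub_nonneg.2 x.2.2)
  refine Finset.prod_le_prod (fun i _ => pow_nonneg (mul_nonneg (h0 _ _) (h0 _ _)) _) fun i _ => ?_
  rw [nsmul_eq_mul, Real.exp_nat_mul]
  refine pow_le_pow_left₀ (mul_nonneg (h0 _ _) (h0 _ _)) ?_ _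
  refine (mul_le_mul (coin_mgf_le _ _) (coin_mgf_le _ _) (h0 _ _) (Real.exp_pos _).le).trans ?_
  rw [← Real.exp_add]
  exact le_of_eq (by congr 1; ring)

/-- Chernoff's bound for the total score. -/
theorem measureReal_scoreOn_ge_le {n r : ℕ} (s : Finset (Fin n)) (p q : Fin n → unitInterval)
    (a : ℝ) {t : ℝ} (ht : 0 ≤ t) :
    ((tableLaw p r).prod (tableLaw q r)).real {ω | a ≤ (scoreOn s ω : ℝ)} ≤
      Real.exp (-t * a + r * ((∑ i ∈ s, ((p i : ℝ) - q i)) * t + s.card * (t ^ 2 / 4))) := by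
  refine (measure_ge_le_exp_mul_mgf a ht Integrable.of_finite).trans ?_
  rw [Real.exp_add]
  exact mul_le_mul_of_nonneg_left (integral_exp_mul_scoreOn_le s p q t) (Real.exp_pos _).le

theorem measureReal_scoreOn_le_le {n r : ℕ} (s : Finset (Fin n)) (p q : Fin n → unitInterval)
    (a : ℝ) {t : ℝ} (ht : t ≤ 0) :
    ((tableLaw p r).prod (tableLaw q r)).real {ω | (scoreOn s ω : ℝ) ≤ a} ≤
      Real.exp (-t * a + r * ((∑ i ∈ s, ((p i : ℝ) - q i)) * t + s.card * (t ^ 2 / 4))) := by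
  refine (measure_le_le_exp_mul_mgf a ht Integrable.of_finite).trans ?_
  rw [Real.exp_add]
  exact mul_le_mul_of_nonneg_left (integral_exp_mul_scoreOn_le s p q t) (Real.exp_pos _).le

/-! ### Anticoncentration and symmetry of the noise -/

theorem integral_cexp_int_mul (k : ℤ) :
    ∫ θ in (-Real.pi)..Real.pi, Complex.exp (θ * Complex.I * k) =
      if k = 0 then 2 * (Real.pi : ℂ) else 0 := by
  split_ifs with h
  · subst h
    simp
    ring
  · have hk : (Complex.I * k : ℂ) ≠ 0 := mul_ne_zero Complex.I_ne_zero (by exact_mod_cast h)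
    have : ∀ θ : ℝ, Complex.exp (θ * Complex.I * k) = Complex.exp (Complex.I * k * θ) := fun θ => by
      congr 1; ring
    simp_rw [this]
    rw [integral_exp_mul_complex hk, div_eq_zero_iff, sub_eq_zero]
    left
    rw [Complex.exp_eq_exp_iff_exists_int]
    exact ⟨k, by push_cast; ring⟩

/-- Fourier inversion on the integers bounds the atoms by the characteristic function. -/
theorem two_pi_mul_measureReal_eq_le {Ω : Type*} [Fintype Ω] [MeasurableSpace Ω]
    [MeasurableSingletonClass Ω] (μ : Measure Ω) [IsFiniteMeasure μ] (Z : Ω → ℤ) (z : ℤ) :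
    2 * Real.pi * μ.real {ω | Z ω = z} ≤
      ∫ θ in (-Real.pi)..Real.pi, ‖∫ ω, Complex.exp (θ * Complex.I * (Z ω : ℂ)) ∂μ‖ := by
  classical
  have key : ∫ θ in (-Real.pi)..Real.pi, Complex.exp (θ * Complex.I * ((-z : ℤ) : ℂ)) *
      (∫ ω, Complex.exp (θ * Complex.I * (Z ω : ℂ)) ∂μ) =
      ((2 * Real.pi * μ.real {ω | Z ω = z} : ℝ) : ℂ) := by
    have h1 : ∀ θ : ℝ, Complex.exp (θ * Complex.I * ((-z : ℤ) : ℂ)) *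
        (∫ ω, Complex.exp (θ * Complex.I * (Z ω : ℂ)) ∂μ) =
        ∑ ω, (μ.real {ω} : ℂ) * Complex.exp (θ * Complex.I * ((Z ω - z : ℤ) : ℂ)) := by
      intro θ
      rw [integral_fintype Integrable.of_finite, Finset.mul_sum]
      refine Finset.sum_congr rfl fun ω _ => ?_
      rw [Complex.real_smul, mul_left_comm, ← Complex.exp_add]
      congr 2
      push_cast
      ring
    simp_rw [h1]
    rw [intervalIntegral.integral_finsetSum]
    · simp_rw [intervalIntegral.integral_const_mul, integral_cexp_int_mul, sub_eq_zero]
      have h2 : μ.real {ω | Z ω = z} = ∑ ω, if Z ω = z then μ.real {ω} else 0 := by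
        rw [← Finset.sum_filter, sum_measureReal_singleton]
        simp
      rw [h2]
      push_cast
      rw [Finset.mul_sum]
      refine Finset.sum_congr rfl fun ω _ => ?_
      split_ifs <;> simp [mul_comm]
    · intro ω _
      exact Continuous.intervalIntegrable (by fun_prop) _ _
  have h := congrArg norm key
  rw [Complex.norm_real, Real.norm_of_nonneg (by positivity)] at h
  rw [← h]
  refine (intervalIntegral.norm_integral_le_integral_norm (by linarith [Real.pi_pos])).trans_eq ?_
  refine intervalIntegral.integral_congr fun θ _ => ?_
  simp only [norm_mul]
  rw [show (θ * Complex.I * ((-z : ℤ) : ℂ)) = ((θ * (-z : ℤ) : ℝ) : ℂ) * Complex.I by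
    push_cast; ring, Complex.norm_exp_ofReal_mul_I, one_mul]

/-- A Gaussian bound for the characteristic function bounds the atoms. -/
theorem measureReal_eq_le_of_charFun_le {Ω : Type*} [Fintype Ω] [MeasurableSpace Ω]
    [MeasurableSingletonClass Ω] (μ : Measure Ω) [IsFiniteMeasure μ] (Z : Ω → ℤ) (z : ℤ) {b : ℝ}
    (hb : 0 < b) (h : ∀ θ : ℝ, |θ| ≤ Real.pi →
      ‖∫ ω, Complex.exp (θ * Complex.I * (Z ω : ℂ)) ∂μ‖ ≤ Real.exp (-b * θ ^ 2)) :
    2 * Real.pi * μ.real {ω | Z ω = z} ≤ √(Real.pi / b) := by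
  refine (two_pi_mul_measureReal_eq_le μ Z z).trans ?_
  rw [← integral_gaussian, intervalIntegral.integral_of_le (by linarith [Real.pi_pos])]
  -- The Gaussian is positive, so integrating it over the whole line only enlarges the bound.
  refine le_trans ?_ (setIntegral_le_integral (s := Set.Ioc (-Real.pi) Real.pi)
    (integrable_exp_neg_mul_sq hb) (Filter.Eventually.of_forall fun _ => (Real.exp_pos _).le))
  refine setIntegral_mono_on ?_ (integrable_exp_neg_mul_sq hb).integrableOn measurableSet_Ioc ?_
  · refine Continuous.integrableOn_Ioc ?_
    simp_rw [integral_fintype (Integrable.of_finite (μ := μ))]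
    fun_prop
  · intro θ hθ
    exact h θ (abs_le.2 ⟨hθ.1.le, hθ.2⟩)

/-- The two factors are conjugate, so the product is the real number `1 - 2 * p * (1 - p) * (1 - cos
θ)`. The constant combines `p * (1 - p) ≥ 6 / 25` with `1 - cos θ ≥ 2 * θ ^ 2 / π ^ 2`, and `p * (1
- p) ≤ 1 / 4` gives nonnegativity. -/
theorem norm_coin_charFun_sq_le (p : ℝ) (h₀ : 2 / 5 ≤ p) (h₁ : p ≤ 3 / 5) {θ : ℝ}
    (hθ : |θ| ≤ Real.pi) :
    ‖(p * Complex.exp (θ * Complex.I) + (1 - p)) *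
        (p * Complex.exp (-(θ * Complex.I)) + (1 - p))‖ ≤
      Real.exp (-(24 / 25 / Real.pi ^ 2) * θ ^ 2) := by
  have e : (p * Complex.exp (θ * Complex.I) + (1 - p)) *
        (p * Complex.exp (-(θ * Complex.I)) + (1 - p)) =
        ((1 - 2 * (p * (1 - p)) * (1 - Real.cos θ) : ℝ) : ℂ) := by
    have h1 : Complex.exp (θ * Complex.I) * Complex.exp (-(θ * Complex.I)) = 1 := by
      rw [← Complex.exp_add]; simp
    have h2 : 2 * Complex.cos θ = Complex.exp (θ * Complex.I) + Complex.exp (-(θ * Complex.I)) := by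
      rw [Complex.two_cos, neg_mul]
    push_cast
    linear_combination (p : ℂ) ^ 2 * h1 - (p : ℂ) * (1 - p) * h2
  have hc := Real.cos_le_one_sub_mul_cos_sq hθ
  have hp : 6 / 25 ≤ p * (1 - p) := by nlinarith
  have hp' : p * (1 - p) ≤ 1 / 4 := by nlinarith [sq_nonneg (p - 1 / 2)]
  have hc0 := Real.neg_one_le_cos θ
  have hc1 := Real.cos_le_one θ
  rw [e, Complex.norm_real, Real.norm_of_nonneg (by nlinarith)]
  refine le_trans ?_ (Real.add_one_le_exp _)
  have h3 : 2 / Real.pi ^ 2 * θ ^ 2 ≤ 1 - Real.cos θ := by linarith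
  have h4 : (24 / 25 / Real.pi ^ 2) * θ ^ 2 = 12 / 25 * (2 / Real.pi ^ 2 * θ ^ 2) := by ring
  nlinarith

theorem measureReal_scoreOn_eq_le {n r : ℕ} (s : Finset (Fin n)) (p q : Fin n → unitInterval)
    (hpq : ∀ i ∈ s, p i = q i) (h₀ : ∀ i ∈ s, 2 / 5 ≤ (p i : ℝ)) (h₁ : ∀ i ∈ s, (p i : ℝ) ≤ 3 / 5)
    (hM : 0 < s.card * r) (z : ℤ) :
    ((tableLaw p r).prod (tableLaw q r)).real {ω | scoreOn s ω = z} ≤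
      1 / √((s.card * r : ℕ) : ℝ) := by
  set M : ℝ := ((s.card * r : ℕ) : ℝ) with hMdef
  have hM' : 0 < M := Nat.cast_pos.2 hM
  have hpi := Real.pi_pos
  have hb : 0 < 24 / 25 / Real.pi ^ 2 * M := by positivity
  have h := measureReal_eq_le_of_charFun_le ((tableLaw p r).prod (tableLaw q r))
    (scoreOn s) z hb fun θ hθ => by
      rw [integral_cexp_mul_scoreOn, norm_prod]
      calc _ ≤ ∏ i ∈ s, Real.exp (-(24 / 25 / Real.pi ^ 2) * θ ^ 2) ^ r := by
            refine Finset.prod_le_prod (fun i _ => norm_nonneg _) fun i hi => ?_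
            rw [norm_pow, ← hpq i hi]
            exact pow_le_pow_left₀ (norm_nonneg _)
              (norm_coin_charFun_sq_le (p i) (h₀ i hi) (h₁ i hi) hθ) _
        _ = _ := by
            rw [Finset.prod_const, ← pow_mul, ← Real.exp_nat_mul, mul_comm r, ← hMdef]
            congr 1
            ring
  -- After squaring this reduces to `25 / 24 * π ≤ 4`.
  have hs : √(Real.pi / (24 / 25 / Real.pi ^ 2 * M)) ≤ 2 * Real.pi * (1 / √M) := by
    rw [Real.sqrt_le_left (by positivity), mul_pow, div_pow, Real.sq_sqrt hM'.le]
    have e : Real.pi / (24 / 25 / Real.pi ^ 2 * M) = Real.pi ^ 2 / M * (25 / 24 * Real.pi) := by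
      field_simp
    have e2 : (2 * Real.pi) ^ 2 * (1 ^ 2 / M) = Real.pi ^ 2 / M * 4 := by ring
    rw [e, e2]
    have := Real.pi_lt_d2
    gcongr
    linarith
  exact le_of_mul_le_mul_left (h.trans hs) (by positivity)

/-- Replacing the frequency by its negative swaps the two factors belonging to a coordinate, which
changes nothing when the means agree. The characteristic function is thus even, and it determines
the law. -/
theorem map_neg_scoreOn {n r : ℕ} (s : Finset (Fin n)) (p q : Fin n → unitInterval)
    (hpq : ∀ i ∈ s, p i = q i) :
    ((tableLaw p r).prod (tableLaw q r)).map (fun ω => -(scoreOn s ω : ℝ)) =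
      ((tableLaw p r).prod (tableLaw q r)).map (fun ω => (scoreOn s ω : ℝ)) := by
  have := Measure.isProbabilityMeasure_map (μ := (tableLaw p r).prod (tableLaw q r))
    (f := fun ω => -(scoreOn s ω : ℝ)) Measurable.of_discrete.aemeasurable
  have := Measure.isProbabilityMeasure_map (μ := (tableLaw p r).prod (tableLaw q r))
    (f := fun ω => (scoreOn s ω : ℝ)) Measurable.of_discrete.aemeasurable
  refine Measure.ext_of_charFun (funext fun t => ?_)
  rw [charFun_apply_real, charFun_apply_real,
    integral_map Measurable.of_discrete.aemeasurable (by fun_prop),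
    integral_map Measurable.of_discrete.aemeasurable (by fun_prop)]
  have h1 := integral_cexp_mul_scoreOn (r := r) s p q (-(t * Complex.I))
  have h2 := integral_cexp_mul_scoreOn (r := r) s p q (t * Complex.I)
  calc _ = ∫ ω, Complex.exp (-(t * Complex.I) * (scoreOn s ω : ℂ))
        ∂((tableLaw p r).prod (tableLaw q r)) := by
        refine integral_congr_ae (Filter.Eventually.of_forall fun ω => ?_)
        push_cast; ring_nf
    _ = ∫ ω, Complex.exp ((t * Complex.I) * (scoreOn s ω : ℂ))
        ∂((tableLaw p r).prod (tableLaw q r)) := by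
        rw [h1, h2]
        refine Finset.prod_congr rfl fun i hi => ?_
        rw [hpq i hi, neg_neg, mul_comm ((q i : ℝ) * Complex.exp (-(t * Complex.I)) + _ : ℂ)]
    _ = _ := by
        refine integral_congr_ae (Filter.Eventually.of_forall fun ω => ?_)
        push_cast; ring_nf

/-- The score is an integer, so the event is a union of `2 * ⌊t⌋ + 1` atoms. -/
theorem measureReal_abs_scoreOn_le {n r : ℕ} (s : Finset (Fin n)) (p q : Fin n → unitInterval)
    (hpq : ∀ i ∈ s, p i = q i) (h₀ : ∀ i ∈ s, 2 / 5 ≤ (p i : ℝ)) (h₁ : ∀ i ∈ s, (p i : ℝ) ≤ 3 / 5)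
    (hM : 0 < s.card * r) {t : ℝ} (ht : 0 ≤ t) :
    ((tableLaw p r).prod (tableLaw q r)).real {ω | |(scoreOn s ω : ℝ)| ≤ t} ≤
      (2 * t + 1) / √((s.card * r : ℕ) : ℝ) := by
  set μ := (tableLaw p r).prod (tableLaw q r)
  have hfl : 0 ≤ ⌊t⌋ := Int.floor_nonneg.2 ht
  have hsub : {ω | |(scoreOn s ω : ℝ)| ≤ t} ⊆
      ⋃ z ∈ Finset.Icc (-⌊t⌋) ⌊t⌋, {ω : Table n r × Table n r | scoreOn s ω = z} := by
    intro ω hω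
    have h : |scoreOn s ω| ≤ ⌊t⌋ := Int.le_floor.2 (by push_cast; exact hω)
    simpa using abs_le.1 h
  calc μ.real {ω | |(scoreOn s ω : ℝ)| ≤ t}
      ≤ ∑ z ∈ Finset.Icc (-⌊t⌋) ⌊t⌋, μ.real {ω | scoreOn s ω = z} :=
        (measureReal_mono hsub (measure_ne_top _ _)).trans (measureReal_biUnion_finset_le _ _)
    _ ≤ ∑ z ∈ Finset.Icc (-⌊t⌋) ⌊t⌋, 1 / √((s.card * r : ℕ) : ℝ) :=
        Finset.sum_le_sum fun z _ => measureReal_scoreOn_eq_le s p q hpq h₀ h₁ hM z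
    _ = ((Finset.Icc (-⌊t⌋) ⌊t⌋).card : ℝ) / √((s.card * r : ℕ) : ℝ) := by
        rw [Finset.sum_const, nsmul_eq_mul, mul_one_div]
    _ ≤ _ := by
        gcongr
        have h1 : ((Finset.Icc (-⌊t⌋) ⌊t⌋).card : ℤ) = 2 * ⌊t⌋ + 1 := by
          rw [Int.card_Icc]; omega
        have h2 : ((Finset.Icc (-⌊t⌋) ⌊t⌋).card : ℝ) = 2 * ⌊t⌋ + 1 := by exact_mod_cast h1
        linarith [Int.floor_le t]

theorem le_measureReal_scoreOn_lt {n r : ℕ} (s : Finset (Fin n)) (p q : Fin n → unitInterval)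
    (hpq : ∀ i ∈ s, p i = q i) (h₀ : ∀ i ∈ s, 2 / 5 ≤ (p i : ℝ)) (h₁ : ∀ i ∈ s, (p i : ℝ) ≤ 3 / 5)
    (hM : 0 < s.card * r) {t : ℝ} (ht : 0 ≤ t) :
    (1 - (2 * t + 1) / √((s.card * r : ℕ) : ℝ)) / 2 ≤
      ((tableLaw p r).prod (tableLaw q r)).real {ω | (scoreOn s ω : ℝ) < -t} := by
  have h := measureReal_abs_scoreOn_le s p q hpq h₀ h₁ hM ht
  set μ := (tableLaw p r).prod (tableLaw q r)
  have hsymm : μ.real {ω | t < (scoreOn s ω : ℝ)} = μ.real {ω | (scoreOn s ω : ℝ) < -t} := by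
    have e := congrArg (fun ν => ν.real (Set.Iio (-t))) (map_neg_scoreOn (r := r) s p q hpq)
    beta_reduce at e
    rw [map_measureReal_apply Measurable.of_discrete measurableSet_Iio,
      map_measureReal_apply Measurable.of_discrete measurableSet_Iio] at e
    simpa [Set.preimage] using e
  have hcover : (Set.univ : Set (Table n r × Table n r)) ⊆ {ω | |(scoreOn s ω : ℝ)| ≤ t} ∪
      ({ω | t < (scoreOn s ω : ℝ)} ∪ {ω | (scoreOn s ω : ℝ) < -t}) := by
    intro ω _
    by_contra hc
    simp only [Set.mem_union, Set.mem_ofPred_eq, not_or, not_lt, abs_le, not_and] at hc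
    linarith [hc.1 hc.2.2]
  have h1 : (1 : ℝ) ≤ _ := (probReal_univ (μ := μ)).symm.le.trans (measureReal_mono hcover)
  have h2 := measureReal_union_le (μ := μ) {ω | |(scoreOn s ω : ℝ)| ≤ t}
    ({ω | t < (scoreOn s ω : ℝ)} ∪ {ω | (scoreOn s ω : ℝ) < -t})
  have h3 := measureReal_union_le (μ := μ) {ω | t < (scoreOn s ω : ℝ)}
    {ω | (scoreOn s ω : ℝ) < -t}
  linarith

/-! ### Failure of counting below `n / Δ ^ 2` samples -/

/-- When the two tables differ in mean on at most two coordinates, and the total difference `Δ`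
there is small against the noise of the others, the total score is negative with probability
above `1/4`. -/
theorem one_fourth_lt_measureReal_score_neg {n r : ℕ} (s : Finset (Fin n))
    (p q : Fin n → unitInterval) (hs : s.card ≤ 2) (hpq : ∀ i ∉ s, p i = q i)
    (h₀ : ∀ i ∉ s, 2 / 5 ≤ (p i : ℝ)) (h₁ : ∀ i ∉ s, (p i : ℝ) ≤ 3 / 5) {Δ : ℝ} (hΔ₀ : 0 < Δ)
    (hΔ₁ : Δ ≤ 1 / 2) (hΔ : ∑ i ∈ s, ((p i : ℝ) - q i) ≤ Δ) (hr : 8 ≤ r * Δ ^ 2)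
    (hn : 106 * (r * Δ ^ 2) ≤ n - 2) :
    1 / 4 < ((tableLaw p r).prod (tableLaw q r)).real {ω | ∑ i, score ω.1 ω.2 i < 0} := by
  have hr0 : 0 < (r : ℝ) := by
    by_contra hc
    nlinarith [sq_nonneg Δ]
  have hcard : s.card + sᶜ.card = n := by simp
  have hcard' : (n : ℝ) - 2 ≤ (sᶜ.card : ℝ) := by
    have h1 : (s.card : ℝ) + sᶜ.card = n := by exact_mod_cast hcard
    have h2 : (s.card : ℝ) ≤ 2 := by exact_mod_cast hs
    linarith
  have hc0 : 0 < (sᶜ.card : ℝ) := by linarith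
  have hM : 0 < sᶜ.card * r := by
    have : 0 < (sᶜ.card : ℝ) * r := by positivity
    exact_mod_cast this
  -- The level is twice the bound on the mean signal. The noise falls below its negative with
  -- probability at least `(1 - 2/5) / 2 = 3/10`, the signal reaches it with probability at most
  -- `1/21`, and `3/10 - 1/21 > 1/4`.
  have ht : 0 ≤ 2 * (r * Δ) := by positivity
  have hA := le_measureReal_scoreOn_lt (r := r) sᶜ p q (fun i hi => hpq i (Finset.mem_compl.1 hi))
    (fun i hi => h₀ i (Finset.mem_compl.1 hi)) (fun i hi => h₁ i (Finset.mem_compl.1 hi)) hM ht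
  have hB := measureReal_scoreOn_ge_le (r := r) s p q (2 * (r * Δ)) hΔ₀.le
  set μ := (tableLaw p r).prod (tableLaw q r)
  have hsub : {ω : Table n r × Table n r | (scoreOn sᶜ ω : ℝ) < -(2 * (r * Δ))} ⊆
      {ω | ∑ i, score ω.1 ω.2 i < 0} ∪ {ω | 2 * (r * Δ) ≤ (scoreOn s ω : ℝ)} := by
    intro ω hω
    by_cases h : 2 * (r * Δ) ≤ (scoreOn s ω : ℝ)
    · exact Or.inr h
    · left
      have e : (∑ i, score ω.1 ω.2 i : ℤ) = scoreOn s ω + scoreOn sᶜ ω :=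
        (Finset.sum_add_sum_compl s _).symm
      simp only [Set.mem_ofPred_eq, not_le] at h hω ⊢
      rw [e]
      have : ((scoreOn s ω + scoreOn sᶜ ω : ℤ) : ℝ) < 0 := by push_cast; linarith
      exact_mod_cast this
  have hC := (measureReal_mono (μ := μ) hsub).trans (measureReal_union_le _ _)
  have hexp : Real.exp (-Δ * (2 * (r * Δ)) +
      r * ((∑ i ∈ s, ((p i : ℝ) - q i)) * Δ + s.card * (Δ ^ 2 / 4))) ≤ 1 / 21 := by
    have h2 : (s.card : ℝ) ≤ 2 := by exact_mod_cast hs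
    have h3 : (∑ i ∈ s, ((p i : ℝ) - q i)) * Δ + s.card * (Δ ^ 2 / 4) ≤
        Δ * Δ + 2 * (Δ ^ 2 / 4) := by gcongr
    have h4 := mul_le_mul_of_nonneg_left h3 hr0.le
    -- The exponent is at most `(-2 + 1 + 1/2) * r * Δ ^ 2`, and `r * Δ ^ 2 ≥ 8`.
    have h5 : -Δ * (2 * (r * Δ)) +
      r * ((∑ i ∈ s, ((p i : ℝ) - q i)) * Δ + s.card * (Δ ^ 2 / 4)) ≤ -4 := by nlinarith
    refine (Real.exp_le_exp.2 h5).trans ?_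
    rw [Real.exp_neg, inv_eq_one_div]
    refine one_div_le_one_div_of_le (by norm_num) ?_
    have h6 : Real.exp 4 = Real.exp 1 ^ 4 := by rw [← Real.exp_nat_mul]; norm_num
    rw [h6]
    exact le_trans (by norm_num) (pow_le_pow_left₀ (by norm_num) Real.exp_one_gt_d9.le 4)
  have hsq : (2 * (2 * (r * Δ)) + 1) / √((sᶜ.card * r : ℕ) : ℝ) ≤ 2 / 5 := by
    have hpos : 0 < √((sᶜ.card * r : ℕ) : ℝ) := Real.sqrt_pos.2 (by exact_mod_cast hM)
    rw [div_le_iff₀ hpos]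
    have h1 : 16 ≤ r * Δ := by nlinarith
    have h2 : 41 / 4 * (r * Δ) ≤ √((sᶜ.card * r : ℕ) : ℝ) := by
      apply Real.le_sqrt_of_sq_le
      push_cast
      have h3 : 106 * (r * Δ ^ 2) * r ≤ sᶜ.card * r :=
        mul_le_mul_of_nonneg_right (hn.trans hcard') hr0.le
      nlinarith [sq_nonneg (r * Δ)]
    linarith
  linarith

/-- The number of samples is forced up to `n / (128 Δ²)` if the success probability stays below
the threshold in the range of sample sizes of `one_fourth_lt_measureReal_score_neg`. -/
theorem le_rMin_of_lt {n : ℕ} (hn : 1152 ≤ n) {Δ : ℝ} (hΔ₀ : 0 < Δ) (hΔ₁ : Δ ≤ 1 / 2)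
    (succ : ℕ → ℝ) (x : ℝ) (h : ∀ r : ℕ, 8 ≤ r * Δ ^ 2 → 106 * (r * Δ ^ 2) ≤ (n : ℝ) - 2 →
      succ r < x) :
    ENNReal.ofReal ((n : ℝ) / (128 * Δ ^ 2)) ≤ rMin succ x := by
  refine le_iInf₂ fun r₀ hr₀ => ?_
  rw [← ENNReal.ofReal_natCast]
  refine ENNReal.ofReal_le_ofReal ?_
  by_contra hc
  push Not at hc
  have hn' : (1152 : ℝ) ≤ n := by exact_mod_cast hn
  set a : ℝ := (n : ℝ) / (128 * Δ ^ 2) with ha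
  have hΔ2 : 0 < Δ ^ 2 := by positivity
  have haΔ : a * Δ ^ 2 = n / 128 := by rw [ha]; field_simp
  have hΔ4 : Δ ^ 2 ≤ 1 / 4 := by nlinarith
  have ha0 : 0 < a := by positivity
  have hceil : 0 < ⌈a⌉₊ := Nat.ceil_pos.2 ha0
  -- Failure at a single sample size `r ≥ r₀` suffices; the largest `r` below `a` is used. Since
  -- `1152 = 9 * 128`, it satisfies `r * Δ ^ 2 ≥ 9 - 1/4`.
  obtain ⟨r, hr⟩ : ∃ r, ⌈a⌉₊ = r + 1 := ⟨⌈a⌉₊ - 1, by omega⟩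
  have hra : (r : ℝ) < a := Nat.lt_ceil.1 (by omega)
  have har : a ≤ r + 1 := by
    have := Nat.le_ceil a
    rw [hr] at this
    exact_mod_cast this
  have hle : r₀ ≤ r := by
    have : r₀ < ⌈a⌉₊ := Nat.lt_ceil.2 hc
    omega
  refine absurd (hr₀ r hle) (not_le.2 (h r ?_ ?_))
  · nlinarith
  · nlinarith

/-! ### Success probabilities in Domination -/

theorem one_sub_measureReal_le_integral {Ω : Type*} [Finite Ω] [MeasurableSpace Ω]
    [MeasurableSingletonClass Ω] (μ : Measure Ω) [IsProbabilityMeasure μ] (B : Set Ω)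
    (f : Ω → ℝ) (h₀ : ∀ ω, 0 ≤ f ω) (h₁ : ∀ ω, ω ∉ B → f ω = 1) :
    1 - μ.real B ≤ ∫ ω, f ω ∂μ := by
  rw [← probReal_compl_eq_one_sub (Set.toFinite B).measurableSet,
    ← integral_indicator_one (Set.toFinite _).measurableSet]
  refine integral_mono Integrable.of_finite Integrable.of_finite fun ω => ?_
  by_cases h : ω ∈ Bᶜ
  · rw [Set.indicator_of_mem h, h₁ ω h]; rfl
  · rw [Set.indicator_of_notMem h]; exact h₀ ω

theorem integral_le_one_sub_measureReal {Ω : Type*} [Finite Ω] [MeasurableSpace Ω]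
    [MeasurableSingletonClass Ω] (μ : Measure Ω) [IsProbabilityMeasure μ] (B : Set Ω)
    (f : Ω → ℝ) (h₀ : ∀ ω, f ω ≤ 1) (h₁ : ∀ ω ∈ B, f ω = 0) :
    ∫ ω, f ω ∂μ ≤ 1 - μ.real B := by
  rw [← probReal_compl_eq_one_sub (Set.toFinite B).measurableSet,
    ← integral_indicator_one (Set.toFinite _).measurableSet]
  refine integral_mono Integrable.of_finite Integrable.of_finite fun ω => ?_
  by_cases h : ω ∈ Bᶜ
  · rw [Set.indicator_of_mem h]; exact h₀ ω
  · rw [Set.indicator_of_notMem h, h₁ ω (not_not.1 h)]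

theorem pmf_toReal_le_one {α : Type*} (p : PMF α) (a : α) : (p a).toReal ≤ 1 :=
  ENNReal.toReal_le_of_le_ofReal zero_le_one (by simpa using p.coe_le_one a)

theorem score_swap {n r : ℕ} (X Y : Table n r) (i : Fin n) : score Y X i = -score X Y i := by
  simp [score]

theorem measureReal_tableLaw_swap {n r : ℕ} (p q : Fin n → unitInterval)
    (B : Set (Table n r × Table n r)) :
    ((tableLaw q r).prod (tableLaw p r)).real (Prod.swap ⁻¹' B) =
      ((tableLaw p r).prod (tableLaw q r)).real B := by
  rw [← Measure.prod_swap (μ := tableLaw q r) (ν := tableLaw p r),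
    map_measureReal_apply measurable_swap (Set.toFinite B).measurableSet]

/-- Exchanging the tables carries one hidden bit to the other, so a single bad event `B` handles
both. -/
theorem DominationInstance.le_successProb {n : ℕ} (C : DominationInstance n)
    (A : DominationAlgorithm) (r : ℕ) (B : Set (Table n r × Table n r))
    (h₀ : ∀ X Y, (X, Y) ∉ B → A n r X Y false = 1) (h₁ : ∀ X Y, (Y, X) ∉ B → A n r X Y true = 1) :
    1 - ((tableLaw C.p r).prod (tableLaw C.q r)).real B ≤ C.successProb A r := by
  have e0 := one_sub_measureReal_le_integral ((tableLaw C.p r).prod (tableLaw C.q r)) B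
    (fun s => (A n r s.1 s.2 false).toReal) (fun _ => ENNReal.toReal_nonneg)
    (fun s hs => by rw [h₀ _ _ hs, ENNReal.toReal_one])
  have e1 := one_sub_measureReal_le_integral ((tableLaw C.q r).prod (tableLaw C.p r))
    (Prod.swap ⁻¹' B)
    (fun s => (A n r s.1 s.2 true).toReal) (fun _ => ENNReal.toReal_nonneg)
    (fun s hs => by rw [h₁ _ _ hs, ENNReal.toReal_one])
  rw [measureReal_tableLaw_swap] at e1
  simp only [DominationInstance.successProb, DominationInstance.sampleLaw, Fintype.sum_bool,
    if_true, Bool.true_eq_false, if_false]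
  linarith

theorem DominationInstance.successProb_le {n : ℕ} (C : DominationInstance n)
    (A : DominationAlgorithm) (r : ℕ) (B : Set (Table n r × Table n r))
    (h₀ : ∀ X Y, (X, Y) ∈ B → A n r X Y false = 0) (h₁ : ∀ X Y, (Y, X) ∈ B → A n r X Y true = 0) :
    C.successProb A r ≤ 1 - ((tableLaw C.p r).prod (tableLaw C.q r)).real B := by
  have e0 := integral_le_one_sub_measureReal ((tableLaw C.p r).prod (tableLaw C.q r)) B
    (fun s => (A n r s.1 s.2 false).toReal) (fun _ => pmf_toReal_le_one _ _)
    (fun s hs => by rw [h₀ _ _ hs, ENNReal.toReal_zero])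
  have e1 := integral_le_one_sub_measureReal ((tableLaw C.q r).prod (tableLaw C.p r))
    (Prod.swap ⁻¹' B)
    (fun s => (A n r s.1 s.2 true).toReal) (fun _ => pmf_toReal_le_one _ _)
    (fun s hs => by rw [h₁ _ _ hs, ENNReal.toReal_zero])
  rw [measureReal_tableLaw_swap] at e1
  simp only [DominationInstance.successProb, DominationInstance.sampleLaw, Fintype.sum_bool,
    if_true, Bool.true_eq_false, if_false]
  linarith

/-! ### The spike instance -/

/-- The instance of Domination whose two vectors are `1/2` except at `i₀`, where they are
`1/2 + ε/2` and `1/2 - ε/2`. -/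
def spikeInstance {n : ℕ} (i₀ : Fin n) (ε : ℝ) (h₀ : 0 ≤ ε) (h₁ : ε ≤ 1) :
    DominationInstance n where
  p i := if i = i₀ then ⟨1 / 2 + ε / 2, by constructor <;> linarith⟩
    else ⟨1 / 2, by constructor <;> norm_num⟩
  q i := if i = i₀ then ⟨1 / 2 - ε / 2, by constructor <;> linarith⟩
    else ⟨1 / 2, by constructor <;> norm_num⟩
  le i := by
    rw [← Subtype.coe_le_coe]
    split_ifs
    · simp only; linarith
    · exact le_rfl

theorem countAlgorithm_successProb_spikeInstance_lt {n : ℕ} (i₀ : Fin n) (ε : ℝ) (h₀ : 0 < ε)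
    (h₁ : ε ≤ 1 / 2) (r : ℕ) (hr : 8 ≤ r * ε ^ 2) (hn : 106 * (r * ε ^ 2) ≤ (n : ℝ) - 2) :
    (spikeInstance i₀ ε h₀.le (by linarith)).successProb countAlgorithm r < 3 / 4 := by
  set C := spikeInstance i₀ ε h₀.le (by linarith) with hC
  have hmain := one_fourth_lt_measureReal_score_neg (r := r) {i₀} C.p C.q (by simp)
    (fun i hi => by simp [hC, spikeInstance, Finset.notMem_singleton.1 hi])
    (fun i hi => by simp [hC, spikeInstance, Finset.notMem_singleton.1 hi]; norm_num)
    (fun i hi => by simp [hC, spikeInstance, Finset.notMem_singleton.1 hi]; norm_num) h₀ h₁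
    (by simp [hC, spikeInstance]) hr hn
  refine (C.successProb_le countAlgorithm r {ω | ∑ i, score ω.1 ω.2 i < 0} ?_ ?_).trans_lt
    (by linarith)
  · intro X Y h
    have h : ∑ i, score X Y i < 0 := h
    simp [countAlgorithm, signDecision, h, h.not_gt]
  · intro X Y h
    have h : ∑ i, score Y X i < 0 := h
    simp_rw [score_swap X Y, Finset.sum_neg_distrib] at h
    have h : 0 < ∑ i, score X Y i := by linarith
    simp [countAlgorithm, signDecision, h]

/-- A strict maximizer leaves no freedom in breaking ties: the choice is a point mass. -/
theorem IsMaxAlgorithm.eq_signDecision {A : DominationAlgorithm} (hA : IsMaxAlgorithm A) {n r : ℕ}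
    {X Y : Table n r} (i₀ : Fin n) (h : ∀ j ≠ i₀, |score X Y j| < |score X Y i₀|) :
    A n r X Y = signDecision (score X Y i₀) := by
  obtain ⟨choice, hc, hAc⟩ := hA n r i₀.pos X Y
  have hs : ∀ i ∈ choice.support, i = i₀ := fun i hi => by
    by_contra hne
    exact absurd (h i hne) (not_lt.2 (hc i hi i₀))
  have hp : choice = PMF.pure i₀ := by
    ext j
    by_cases hj : j = i₀
    · rw [hj, PMF.pure_apply_self, PMF.apply_eq_one_iff]
      exact choice.support_nonempty.subset_singleton_iff.1 hs
    · rw [PMF.pure_apply_of_ne _ _ hj, PMF.apply_eq_zero_iff]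
      exact fun h => hj (hs j h)
  rw [hAc, hp, PMF.pure_bind]

theorem spikeInstance_measureReal_le {n : ℕ} (i₀ : Fin n) (ε : ℝ) (h₀ : 0 ≤ ε) (h₁ : ε ≤ 1)
    (r : ℕ) :
    ((tableLaw (spikeInstance i₀ ε h₀ h₁).p r).prod (tableLaw (spikeInstance i₀ ε h₀ h₁).q r)).real
      {ω | ¬ (0 < score ω.1 ω.2 i₀ ∧ ∀ j ≠ i₀, |score ω.1 ω.2 j| < score ω.1 ω.2 i₀)} ≤
      2 * n * Real.exp (-(r * ε ^ 2 / 4)) := by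
  set C := spikeInstance i₀ ε h₀ h₁ with hC
  set μ := (tableLaw C.p r).prod (tableLaw C.q r) with hμ
  -- Half the mean of the spike's score. Tilts `±ε` are optimal in the Chernoff bounds, and all of
  -- them have exponent `-(r * ε ^ 2 / 4)`.
  set a : ℝ := r * ε / 2 with ha
  have ha0 : 0 ≤ a := by positivity
  have hsub : {ω : Table n r × Table n r | ¬ (0 < score ω.1 ω.2 i₀ ∧
      ∀ j ≠ i₀, |score ω.1 ω.2 j| < score ω.1 ω.2 i₀)} ⊆
      {ω | (scoreOn {i₀} ω : ℝ) ≤ a} ∪ ⋃ j ∈ Finset.univ.erase i₀,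
        ({ω | a ≤ (scoreOn {j} ω : ℝ)} ∪ {ω | (scoreOn {j} ω : ℝ) ≤ -a}) := by
    intro ω hω
    by_contra hc
    simp only [Set.mem_union, Set.mem_iUnion, Set.mem_ofPred_eq, not_or, not_exists, not_le,
      scoreOn, Finset.sum_singleton, Finset.mem_erase, Finset.mem_univ, and_true] at hc
    refine hω ⟨?_, fun j hj => ?_⟩
    · exact_mod_cast ha0.trans_lt hc.1
    · have := abs_lt.2 ⟨(hc.2 j hj).2, (hc.2 j hj).1⟩
      have := this.trans hc.1
      exact_mod_cast this
  have hi₀ : μ.real {ω | (scoreOn {i₀} ω : ℝ) ≤ a} ≤ Real.exp (-(r * ε ^ 2 / 4)) := by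
    refine (measureReal_scoreOn_le_le {i₀} C.p C.q a (neg_nonpos.2 h₀)).trans_eq ?_
    congr 1
    simp [hC, spikeInstance, ha]
    ring
  have hj : ∀ j ∈ Finset.univ.erase i₀, μ.real ({ω | a ≤ (scoreOn {j} ω : ℝ)} ∪
      {ω | (scoreOn {j} ω : ℝ) ≤ -a}) ≤ 2 * Real.exp (-(r * ε ^ 2 / 4)) := by
    intro j hj
    have hj := Finset.ne_of_mem_erase hj
    refine (measureReal_union_le _ _).trans ?_
    rw [two_mul]
    refine add_le_add ?_ ?_
    · refine (measureReal_scoreOn_ge_le {j} C.p C.q a h₀).trans_eq ?_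
      congr 1
      simp [hC, spikeInstance, ha, hj]
      ring
    · refine (measureReal_scoreOn_le_le {j} C.p C.q (-a) (neg_nonpos.2 h₀)).trans_eq ?_
      congr 1
      simp [hC, spikeInstance, ha, hj]
      ring
  calc _ ≤ _ := measureReal_mono hsub
    _ ≤ _ := measureReal_union_le _ _
    _ ≤ Real.exp (-(r * ε ^ 2 / 4)) +
        ∑ j ∈ Finset.univ.erase i₀, 2 * Real.exp (-(r * ε ^ 2 / 4)) :=
      add_le_add hi₀ ((measureReal_biUnion_finset_le _ _).trans (Finset.sum_le_sum hj))
    _ ≤ _ := by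
      rw [Finset.sum_const, Finset.card_erase_of_mem (Finset.mem_univ _), Finset.card_univ,
        Fintype.card_fin, nsmul_eq_mul, Nat.cast_pred i₀.pos]
      nlinarith [Real.exp_pos (-(r * ε ^ 2 / 4))]

theorem exists_spikeInstance_separation :
    ∃ n₀ : ℕ, ∀ n : ℕ, n₀ ≤ n → ∀ ε : ℝ, 0 < ε → ε < 1 / 10 →
      ∃ C : DominationInstance n,
        (∀ A : DominationAlgorithm, IsMaxAlgorithm A →
          C.rMin A (1 - 2 / (n : ℝ)) ≤ ENNReal.ofReal (16 * Real.log n / ε ^ 2)) ∧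
        ENNReal.ofReal ((n : ℝ) / (128 * ε ^ 2)) ≤ C.rMin countAlgorithm (3 / 4) := by
  refine ⟨1152, fun n hn ε h₀ h₁ => ?_⟩
  have hn0 : 0 < n := by omega
  have hnR : (1152 : ℝ) ≤ n := by exact_mod_cast hn
  refine ⟨spikeInstance ⟨0, hn0⟩ ε h₀.le (by linarith), fun A hA => ?_,
    le_rMin_of_lt hn h₀ (by linarith) _ _ fun r hr hr' =>
      countAlgorithm_successProb_spikeInstance_lt _ ε h₀ (by linarith) r hr hr'⟩
  set C := spikeInstance ⟨0, hn0⟩ ε h₀.le (by linarith) with hC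
  have hlog : 1 ≤ Real.log n := by
    rw [Real.le_log_iff_exp_le (by linarith)]
    linarith [Real.exp_one_lt_d9]
  have hpos : 0 ≤ 16 * Real.log n / ε ^ 2 := by positivity
  -- The floor keeps the bound free of an extra `+ 1`. The lost sample is harmless, because `r * ε ^
  -- 2 / 4 ≥ 2 * log n` is enough.
  refine (iInf₂_le ⌊16 * Real.log n / ε ^ 2⌋₊ ?_).trans ?_
  · intro r hr
    refine le_trans ?_ (C.le_successProb A r {ω | ¬ (0 < score ω.1 ω.2 ⟨0, hn0⟩ ∧
      ∀ j ≠ ⟨0, hn0⟩, |score ω.1 ω.2 j| < score ω.1 ω.2 ⟨0, hn0⟩)} ?_ ?_)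
    · refine sub_le_sub_left ((spikeInstance_measureReal_le _ ε h₀.le _ r).trans ?_) 1
      have h1 : 16 * Real.log n / ε ^ 2 ≤ r + 1 := by
        have h2 : (⌊16 * Real.log n / ε ^ 2⌋₊ : ℝ) ≤ r := by exact_mod_cast hr
        linarith [Nat.lt_floor_add_one (16 * Real.log n / ε ^ 2)]
      rw [div_le_iff₀ (by positivity)] at h1
      have h3 : Real.exp (-(r * ε ^ 2 / 4)) ≤ ((n : ℝ) ^ 2)⁻¹ := by
        have h4 : ((n : ℝ) ^ 2)⁻¹ = Real.exp (-(2 * Real.log n)) := by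
          rw [Real.exp_neg, two_mul, Real.exp_add, Real.exp_log (by linarith), sq]
        rw [h4, Real.exp_le_exp]
        nlinarith
      calc 2 * n * Real.exp (-(r * ε ^ 2 / 4)) ≤ 2 * n * ((n : ℝ) ^ 2)⁻¹ := by gcongr
        _ = 2 / n := by field_simp
    · intro X Y h
      have h := not_not.1 h
      simp only at h
      rw [hA.eq_signDecision _ fun j hj => (h.2 j hj).trans_le (le_abs_self _)]
      simp [signDecision, h.1]
    · intro X Y h
      have h := not_not.1 h
      simp only [score_swap X Y, abs_neg] at h
      rw [hA.eq_signDecision _ fun j hj => (h.2 j hj).trans_le (neg_le_abs _)]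
      have h' : score X Y ⟨0, hn0⟩ < 0 := by linarith [h.1]
      simp [signDecision, h', h'.not_gt]
  · rw [← ENNReal.ofReal_natCast]
    exact ENNReal.ofReal_le_ofReal (Nat.floor_le hpos)

/-! ### Counting in Top-K, by reduction to two rows -/

theorem TopKInstance.sampleLaw_eq_pi {n : ℕ} (S : TopKInstance n) (π : Equiv.Perm (Fin n))
    (r : ℕ) :
    S.sampleLaw π r = Measure.pi fun i => tableLaw (fun j => S.P (π.symm i) (π.symm j)) r :=
  rfl

instance TopKInstance.sampleLaw.instIsProbabilityMeasure {n : ℕ} (S : TopKInstance n)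
    (π : Equiv.Perm (Fin n)) (r : ℕ) : IsProbabilityMeasure (S.sampleLaw π r) := by
  rw [S.sampleLaw_eq_pi]; infer_instance

/-- The comparisons made for two different items are independent tables. -/
theorem TopKInstance.map_sampleLaw_pair {n : ℕ} (S : TopKInstance n) (π : Equiv.Perm (Fin n))
    (r : ℕ) {a b : Fin n} (hab : a ≠ b) :
    (S.sampleLaw π r).map (fun X => (X a, X b)) =
      (tableLaw (fun j => S.P (π.symm a) (π.symm j)) r).prod
        (tableLaw (fun j => S.P (π.symm b) (π.symm j)) r) := by
  rw [S.sampleLaw_eq_pi]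
  have hind := (iIndepFun_pi (μ := fun i => tableLaw (fun j => S.P (π.symm i) (π.symm j)) r)
    (X := fun _ => id) fun _ => aemeasurable_id).indepFun hab
  refine (hind.map_prod_eq_prod_map_map (measurable_pi_apply _).aemeasurable
    (measurable_pi_apply _).aemeasurable).trans ?_
  congr 1
  · exact (measurePreserving_eval
      (fun i => tableLaw (fun j => S.P (π.symm i) (π.symm j)) r) a).map_eq
  · exact (measurePreserving_eval
      (fun i => tableLaw (fun j => S.P (π.symm i) (π.symm j)) r) b).map_eq

theorem wins_sub_wins {n r : ℕ} (X : Comparisons n r) (a b : Fin n) :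
    (wins X a : ℤ) - wins X b = ∑ j, score (X a) (X b) j := by
  simp [wins, score, Finset.sum_sub_distrib]

theorem TopKInstance.successProb_lt {n : ℕ} (S : TopKInstance n) (A : TopKAlgorithm) (r : ℕ)
    (x : ℝ) (h : ∀ π, ∫ X, (A n S.k r X (topSet π S.k)).toReal ∂(S.sampleLaw π r) < x) :
    S.successProb A r < x := by
  unfold TopKInstance.successProb
  rw [div_lt_iff₀ (by positivity)]
  refine (Finset.sum_lt_sum_of_nonempty Finset.univ_nonempty fun π _ => h π).trans_eq ?_
  rw [Finset.sum_const, Finset.card_univ, Fintype.card_perm, Fintype.card_fin, nsmul_eq_mul,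
    mul_comm]

theorem TopKInstance.le_successProb {n : ℕ} (S : TopKInstance n) (A : TopKAlgorithm) (r : ℕ)
    (x : ℝ) (h : ∀ π, x ≤ ∫ X, (A n S.k r X (topSet π S.k)).toReal ∂(S.sampleLaw π r)) :
    x ≤ S.successProb A r := by
  unfold TopKInstance.successProb
  rw [le_div_iff₀ (by positivity)]
  refine le_trans (le_of_eq ?_) (Finset.sum_le_sum fun π _ => h π)
  rw [Finset.sum_const, Finset.card_univ, Fintype.card_perm, Fintype.card_fin, nsmul_eq_mul,
    mul_comm]

theorem mem_topSet {n : ℕ} (π : Equiv.Perm (Fin n)) (k : ℕ) (i : Fin n) :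
    i ∈ topSet π k ↔ (π.symm i : ℕ) < k := by
  simp [topSet]

theorem IsCountingAlgorithm.successProb_gapInstance_lt {A : TopKAlgorithm}
    (hA : IsCountingAlgorithm A) {n k : ℕ} (hk₀ : 1 ≤ k) (hk : k < n) (ε : ℝ) (h₀ : 0 < ε)
    (h₁ : ε < 1 / 10) (h₂ : ε ≤ 1 / 2) (r : ℕ) (hr : 8 ≤ r * (2 * ε) ^ 2)
    (hn : 106 * (r * (2 * ε) ^ 2) ≤ (n : ℝ) - 2) :
    (gapInstance n k hk.le ε h₀.le h₂).successProb A r < 3 / 4 := by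
  set S := gapInstance n k hk.le ε h₀.le h₂ with hS
  -- The bound holds for each fixed `π`, hence for the average.
  refine S.successProb_lt A r _ fun π => ?_
  set u : Fin n := ⟨k - 1, by omega⟩ with hu
  set v : Fin n := ⟨k, hk⟩ with hv
  have huv : u < v := by rw [Fin.lt_def]; simp only [hu, hv]; omega
  -- Adjacent ranks compare in the same way with every third one, so their rows agree off two
  -- columns.
  have hvu : ∀ w : Fin n, w ≠ u → w ≠ v → (u < w ↔ v < w) ∧ (w < u ↔ w < v) := fun w h1 h2 => by
    rw [Ne, Fin.ext_iff] at h1 h2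
    simp only [hu, hv, Fin.lt_def] at h1 h2 ⊢
    omega
  have hab : π u ≠ π v := fun h => huv.ne (π.injective h)
  have hmem : ∀ j, j ∉ ({π u, π v} : Finset (Fin n)) → π.symm j ≠ u ∧ π.symm j ≠ v := by
    intro j hj
    simp only [Finset.mem_insert, Finset.mem_singleton, not_or] at hj
    exact ⟨fun h => hj.1 (by rw [← h, Equiv.apply_symm_apply]),
      fun h => hj.2 (by rw [← h, Equiv.apply_symm_apply])⟩
  have hP : ∀ x y, (S.P x y : ℝ) = if x < y then 1 / 2 + ε else if y < x then 1 / 2 - ε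
      else 1 / 2 := by
    intro x y
    simp only [hS, gapInstance, gapMatrix]
    split_ifs <;> rfl
  have hrange : ∀ x y, 2 / 5 ≤ (S.P x y : ℝ) ∧ (S.P x y : ℝ) ≤ 3 / 5 := by
    intro x y
    rw [hP]
    split_ifs <;> constructor <;> linarith
  have hmain := one_fourth_lt_measureReal_score_neg (r := r) {π u, π v}
    (fun j => S.P u (π.symm j)) (fun j => S.P v (π.symm j)) Finset.card_le_two
    (fun j hj => by
      obtain ⟨h1, h2⟩ := hmem j hj
      apply Subtype.ext
      rw [hP, hP]
      simp only [(hvu _ h1 h2).1, (hvu _ h1 h2).2])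
    (fun j _ => (hrange _ _).1) (fun j _ => (hrange _ _).2) (Δ := 2 * ε) (by linarith)
    (by linarith)
    (by
      rw [Finset.sum_pair hab]
      simp only [Equiv.symm_apply_apply, hP, lt_irrefl, if_false, huv, huv.not_gt, if_true]
      linarith) hr hn
  have hlaw := S.map_sampleLaw_pair π r hab
  simp only [Equiv.symm_apply_apply] at hlaw
  rw [← hlaw, map_measureReal_apply Measurable.of_discrete (Set.toFinite _).measurableSet] at hmain
  refine (integral_le_one_sub_measureReal (S.sampleLaw π r) _ _
    (fun X => pmf_toReal_le_one _ _) ?_).trans_lt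
    ((sub_lt_sub_left hmain 1).trans_eq (by norm_num))
  intro X hX
  have hX : ∑ j, score (X (π u)) (X (π v)) j < 0 := hX
  rw [← wins_sub_wins] at hX
  rw [ENNReal.toReal_eq_zero_iff]
  left
  rw [PMF.apply_eq_zero_iff]
  intro hT
  have := (hA n S.k r S.k_le X _ hT).2 (π u)
    (by rw [mem_topSet, Equiv.symm_apply_apply]; simp only [hu, hS, gapInstance]; omega) (π v)
    (by rw [mem_topSet, Equiv.symm_apply_apply]; simp [hv, hS, gapInstance])
  omega

/-! ### Majority votes and the optimal sample complexity -/

/-- The algorithm that decides every comparison by majority and outputs the items that lose fewer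
than `k` of them. -/
def majorityAlgorithm : TopKAlgorithm := fun n k r X =>
  PMF.pure (Finset.univ.filter fun i : Fin n =>
    (Finset.univ.filter fun j => j ≠ i ∧ 2 * ∑ l : Fin r, (X i j l).toNat ≤ r).card < k)

/-- If all votes are correct, an item loses exactly to the better ones, so its number of losses is
its rank. -/
theorem majorityAlgorithm_apply_topSet {n k r : ℕ} (π : Equiv.Perm (Fin n)) (X : Comparisons n r)
    (h : ∀ i j, i ≠ j → (2 * ∑ l, (X i j l).toNat ≤ r ↔ π.symm j < π.symm i)) :
    majorityAlgorithm n k r X (topSet π k) = 1 := by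
  unfold majorityAlgorithm
  rw [PMF.pure_apply, if_pos]
  ext i
  rw [mem_topSet, Finset.mem_filter]
  have e : (Finset.univ.filter fun j => j ≠ i ∧ 2 * ∑ l : Fin r, (X i j l).toNat ≤ r) =
      (Finset.Iio (π.symm i)).map π.toEmbedding := by
    ext j
    simp only [Finset.mem_filter, Finset.mem_univ, true_and, Finset.mem_map_equiv, Finset.mem_Iio]
    refine ⟨fun hj => (h i j hj.1.symm).1 hj.2, fun hj => ?_⟩
    have hne : j ≠ i := fun he => by rw [he] at hj; exact lt_irrefl _ hj
    exact ⟨hne, (h i j hne.symm).2 hj⟩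
  rw [e, Finset.card_map, Fin.card_Iio]
  simp

theorem mgf_sum_comparisons_le {n : ℕ} (S : TopKInstance n) (π : Equiv.Perm (Fin n)) (r : ℕ)
    (i j : Fin n) (t : ℝ) :
    mgf (fun X : Comparisons n r => ∑ l, ((X i j l).toNat : ℝ)) (S.sampleLaw π r) t ≤
      Real.exp (r * (S.P (π.symm i) (π.symm j) * t + t ^ 2 / 8)) := by
  set p := S.P (π.symm i) (π.symm j) with hp
  have hmap : (S.sampleLaw π r).map (fun X => X i j) = Measure.pi fun _ : Fin r => coin p := by
    have h1 := measurePreserving_eval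
      (fun i => tableLaw (fun j => S.P (π.symm i) (π.symm j)) r) i
    have h2 := measurePreserving_eval
      (fun j => Measure.pi fun _ : Fin r => coin (S.P (π.symm i) (π.symm j))) j
    exact (h2.comp h1).map_eq
  have e : mgf (fun X : Comparisons n r => ∑ l, ((X i j l).toNat : ℝ)) (S.sampleLaw π r) t =
      ∫ x : Fin r → Bool, ∏ l, Real.exp (t * ((x l).toNat : ℝ))
        ∂((S.sampleLaw π r).map (fun X => X i j)) := by
    rw [integral_map Measurable.of_discrete.aemeasurable
      Measurable.of_discrete.aestronglyMeasurable]
    simp only [mgf, Finset.mul_sum, Real.exp_sum]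
  rw [e, hmap, integral_fintype_prod_eq_pow (fun b : Bool => Real.exp (t * (b.toNat : ℝ))),
    integral_coin, Fintype.card_fin, Real.exp_nat_mul]
  refine pow_le_pow_left₀ ?_ ?_ _
  · exact add_nonneg (mul_nonneg p.2.1 (Real.exp_pos _).le)
      (mul_nonneg (sub_nonneg.2 p.2.2) (Real.exp_pos _).le)
  · simpa using coin_mgf_le p t

theorem gapInstance_measureReal_majority_le {n k : ℕ} (hk : k ≤ n) (ε : ℝ) (h₀ : 0 ≤ ε)
    (h₁ : ε ≤ 1 / 2) (π : Equiv.Perm (Fin n)) (r : ℕ) {i j : Fin n} (hij : i ≠ j) :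
    ((gapInstance n k hk ε h₀ h₁).sampleLaw π r).real
      {X | ¬ (2 * ∑ l, (X i j l).toNat ≤ r ↔ π.symm j < π.symm i)} ≤
      Real.exp (-(2 * (r * ε ^ 2))) := by
  set S := gapInstance n k hk ε h₀ h₁ with hS
  have hcast : ∀ X : Comparisons n r, (∑ l, ((X i j l).toNat : ℝ)) =
      ((∑ l, (X i j l).toNat : ℕ) : ℝ) := fun X => by push_cast; rfl
  rcases lt_or_gt_of_ne (fun h => hij (π.symm.injective h)) with h | h
  · have hP : (S.P (π.symm i) (π.symm j) : ℝ) = 1 / 2 + ε := by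
      simp [hS, gapInstance, gapMatrix, h]
    -- The tilt `4 * ε` in absolute value minimizes `-ε * t + t ^ 2 / 8`, with minimum `-2 * ε ^ 2`
    -- per sample.
    have hm := mgf_sum_comparisons_le S π r i j (-(4 * ε))
    rw [hP] at hm
    have hsub : {X : Comparisons n r | ¬ (2 * ∑ l, (X i j l).toNat ≤ r ↔ π.symm j < π.symm i)} ⊆
        {X | (∑ l, ((X i j l).toNat : ℝ)) ≤ r / 2} := by
      intro X hX
      simp only [Set.mem_ofPred_eq, h.not_gt, iff_false, not_not] at hX ⊢
      rw [hcast, le_div_iff₀ two_pos, mul_comm]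
      exact_mod_cast hX
    refine (measureReal_mono hsub).trans ((measure_le_le_exp_mul_mgf _ (by linarith)
      Integrable.of_finite).trans ((mul_le_mul_of_nonneg_left hm (Real.exp_pos _).le).trans_eq ?_))
    rw [← Real.exp_add]
    congr 1
    ring
  · have hP : (S.P (π.symm i) (π.symm j) : ℝ) = 1 / 2 - ε := by
      simp [hS, gapInstance, gapMatrix, h, h.not_gt]
    have hm := mgf_sum_comparisons_le S π r i j (4 * ε)
    rw [hP] at hm
    have hsub : {X : Comparisons n r | ¬ (2 * ∑ l, (X i j l).toNat ≤ r ↔ π.symm j < π.symm i)} ⊆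
        {X | (r : ℝ) / 2 ≤ ∑ l, ((X i j l).toNat : ℝ)} := by
      intro X hX
      simp only [Set.mem_ofPred_eq, h, iff_true, not_le] at hX ⊢
      rw [hcast, div_le_iff₀ two_pos, mul_comm]
      exact_mod_cast hX.le
    refine (measureReal_mono hsub).trans ((measure_ge_le_exp_mul_mgf _ (by linarith)
      Integrable.of_finite).trans ((mul_le_mul_of_nonneg_left hm (Real.exp_pos _).le).trans_eq ?_))
    rw [← Real.exp_add]
    congr 1
    ring

theorem le_majorityAlgorithm_successProb_gapInstance {n k : ℕ} (hk : k ≤ n) (ε : ℝ) (h₀ : 0 ≤ ε)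
    (h₁ : ε ≤ 1 / 2) (r : ℕ) :
    1 - (n : ℝ) ^ 2 * Real.exp (-(2 * (r * ε ^ 2))) ≤
      (gapInstance n k hk ε h₀ h₁).successProb majorityAlgorithm r := by
  set S := gapInstance n k hk ε h₀ h₁ with hS
  refine S.le_successProb _ r _ fun π => ?_
  have hgood := one_sub_measureReal_le_integral (S.sampleLaw π r)
    (⋃ z ∈ (Finset.univ : Finset (Fin n × Fin n)).filter fun z => z.1 ≠ z.2,
      {X | ¬ (2 * ∑ l, (X z.1 z.2 l).toNat ≤ r ↔ π.symm z.2 < π.symm z.1)})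
    (fun X => (majorityAlgorithm n S.k r X (topSet π S.k)).toReal)
    (fun _ => ENNReal.toReal_nonneg) (fun X hX => by
      rw [majorityAlgorithm_apply_topSet, ENNReal.toReal_one]
      intro i j hij
      by_contra hc
      exact hX (Set.mem_biUnion (x := (i, j)) (by simpa using hij) hc))
  refine le_trans (sub_le_sub_left ?_ 1) hgood
  refine (measureReal_biUnion_finset_le _ _).trans ?_
  refine (Finset.sum_le_sum fun z hz => gapInstance_measureReal_majority_le hk ε h₀ h₁ π r
    (Finset.mem_filter.1 hz).2).trans ?_
  rw [Finset.sum_const, nsmul_eq_mul]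
  refine mul_le_mul_of_nonneg_right ?_ (Real.exp_pos _).le
  have := Finset.card_filter_le (Finset.univ : Finset (Fin n × Fin n)) fun z => z.1 ≠ z.2
  rw [Finset.card_univ, Fintype.card_prod, Fintype.card_fin] at this
  rw [sq]
  exact_mod_cast this

theorem one_le_log_div_sq {n : ℕ} (hn : 3 ≤ n) {ε : ℝ} (h₀ : 0 < ε) (h₁ : ε < 1) :
    1 ≤ Real.log n / ε ^ 2 := by
  have hnR : (3 : ℝ) ≤ n := by exact_mod_cast hn
  have hlog : 1 ≤ Real.log n := by
    rw [Real.le_log_iff_exp_le (by linarith)]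
    linarith [Real.exp_one_lt_d9]
  rw [le_div_iff₀ (by positivity)]
  nlinarith

theorem gapInstance_rMinOpt_le {n k : ℕ} (hn : 4 ≤ n) (hk : k ≤ n) (ε : ℝ) (h₀ : 0 < ε)
    (h₁ : ε ≤ 1 / 2) :
    (gapInstance n k hk ε h₀.le h₁).rMinOpt (3 / 4) ≤ ENNReal.ofReal (3 * Real.log n / ε ^ 2) := by
  have hnR : (4 : ℝ) ≤ n := by exact_mod_cast hn
  set L := Real.log n / ε ^ 2 with hL
  have hL1 : 1 ≤ L := one_le_log_div_sq (by omega) h₀ (by linarith)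
  -- The factor `3 / 2` makes the error at most `n ^ 2 * n⁻³ = 1 / n`; the rounding of the ceiling
  -- is absorbed by `L ≥ 1`.
  refine (iInf_le _ majorityAlgorithm).trans ((iInf₂_le ⌈3 / 2 * L⌉₊ ?_).trans ?_)
  · intro r hr
    refine le_trans ?_ (le_majorityAlgorithm_successProb_gapInstance hk ε h₀.le h₁ r)
    have hr' : 3 / 2 * L ≤ r := (Nat.le_ceil _).trans (by exact_mod_cast hr)
    have hr2 : 3 * Real.log n ≤ 2 * (r * ε ^ 2) := by
      have h2 := mul_le_mul_of_nonneg_right hr' (sq_nonneg ε)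
      have h3 : L * ε ^ 2 = Real.log n := by rw [hL]; field_simp
      linarith
    have h3 : Real.exp (-(2 * (r * ε ^ 2))) ≤ ((n : ℝ) ^ 3)⁻¹ := by
      have h4 : ((n : ℝ) ^ 3)⁻¹ = Real.exp (-(3 * Real.log n)) := by
        rw [Real.exp_neg, show (3 : ℝ) = (3 : ℕ) by norm_num, Real.exp_nat_mul,
          Real.exp_log (by linarith)]
      rw [h4, Real.exp_le_exp]
      linarith
    have h5 : (n : ℝ) ^ 2 * Real.exp (-(2 * (r * ε ^ 2))) ≤ 1 / 4 := by
      calc (n : ℝ) ^ 2 * Real.exp (-(2 * (r * ε ^ 2))) ≤ (n : ℝ) ^ 2 * ((n : ℝ) ^ 3)⁻¹ := by gcongr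
        _ = 1 / (n : ℝ) := by field_simp
        _ ≤ 1 / 4 := by gcongr
    linarith
  · rw [← ENNReal.ofReal_natCast]
    refine ENNReal.ofReal_le_ofReal ?_
    have := Nat.ceil_lt_add_one (show 0 ≤ 3 / 2 * L by linarith)
    have e : 3 * Real.log n / ε ^ 2 = 3 * L := by rw [hL]; ring
    rw [e]
    linarith

theorem IsCountingAlgorithm.le_rMin_gapInstance {A : TopKAlgorithm} (hA : IsCountingAlgorithm A)
    {n k : ℕ} (hn : 1152 ≤ n) (hk₀ : 1 ≤ k) (hk : k < n) (ε : ℝ) (h₀ : 0 < ε) (h₁ : ε < 1 / 10)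
    (h₂ : ε ≤ 1 / 2) :
    ENNReal.ofReal (1 / 512 * n / ε ^ 2) ≤ (gapInstance n k hk.le ε h₀.le h₂).rMin A (3 / 4) := by
  have h := le_rMin_of_lt hn (Δ := 2 * ε) (by linarith) (by linarith)
    ((gapInstance n k hk.le ε h₀.le h₂).successProb A) (3 / 4) fun r hr hr' =>
      hA.successProb_gapInstance_lt hk₀ hk ε h₀ h₁ h₂ r hr hr'
  have e : (n : ℝ) / (128 * (2 * ε) ^ 2) = 1 / 512 * n / ε ^ 2 := by field_simp; norm_num
  rwa [e] at h

end NoisyTopK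

end

/-! ### Assembling the three statements -/

theorem mainTheorem9 :
    -- the max algorithm beats the counting algorithm on some instance of Domination
    (∃ n₀ : ℕ, ∀ n : ℕ, n₀ ≤ n → ∀ ε : ℝ, 0 < ε → ε < 1 / 10 →
      ∃ C : NoisyTopK.DominationInstance n,
        (∀ A : NoisyTopK.DominationAlgorithm, NoisyTopK.IsMaxAlgorithm A →
          C.rMin A (1 - 2 / (n : ℝ)) ≤ ENNReal.ofReal (16 * Real.log n / ε ^ 2)) ∧
        ENNReal.ofReal ((n : ℝ) / (128 * ε ^ 2)) ≤
          C.rMin NoisyTopK.countAlgorithm (3 / 4)) ∧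
    -- the explicit instance of Top-K on which counting fails
    (∃ c : ℝ, 0 < c ∧ ∃ K : ℝ, 0 < K ∧ ∃ n₀ : ℕ, ∀ n : ℕ, n₀ ≤ n →
      ∀ (ε : ℝ) (h₀ : 0 < ε) (h₁ : ε < 1 / 10) (k : ℕ) (_ : 1 ≤ k) (hk : k < n),
      ∀ S : NoisyTopK.TopKInstance n,
        S = NoisyTopK.gapInstance n k hk.le ε h₀.le (by linarith) →
        S.rMinOpt (3 / 4) ≤ ENNReal.ofReal (K * Real.log n / ε ^ 2) ∧
        ∀ A : NoisyTopK.TopKAlgorithm, NoisyTopK.IsCountingAlgorithm A →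
          ENNReal.ofReal (c * n / ε ^ 2) ≤ S.rMin A (3 / 4) ∧
          ENNReal.ofReal (c * n / Real.log n) * S.rMinOpt (3 / 4) ≤ S.rMin A (3 / 4)) ∧
    -- the competitive ratio of the counting algorithm for Top-K
    (∃ c : ℝ, 0 < c ∧ ∃ n₀ : ℕ, ∀ n : ℕ, n₀ ≤ n →
      ∀ A : NoisyTopK.TopKAlgorithm, NoisyTopK.IsCountingAlgorithm A →
        ∀ f : NNReal, NoisyTopK.IsCompetitive A n f →
          c * n / Real.log n ≤ (f : ℝ)) := by
  refine ⟨NoisyTopK.exists_spikeInstance_separation,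
    -- The ratio constant is `1 / 512`, from counting, divided by the `3` of the majority bound.
    ⟨1 / 1536, by norm_num, 3, by norm_num, 1152, ?_⟩, 1 / 1536, by norm_num, 1152, ?_⟩
  · rintro n hn ε h₀ h₁ k hk₀ hk S rfl
    have hlog : 0 < Real.log n := Real.log_pos (by exact_mod_cast (by omega : 1 < n))
    have hopt := NoisyTopK.gapInstance_rMinOpt_le (by omega) hk.le ε h₀ (by linarith)
    refine ⟨hopt, fun A hA => ?_⟩
    have hcount := hA.le_rMin_gapInstance hn hk₀ hk ε h₀ h₁ (by linarith)
    refine ⟨le_trans (ENNReal.ofReal_le_ofReal ?_) hcount, ?_⟩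
    · gcongr
      norm_num
    · refine ((mul_le_mul_right hopt _).trans_eq ?_).trans hcount
      rw [← ENNReal.ofReal_mul (by positivity)]
      congr 1
      field_simp
      norm_num
  · intro n hn A hA f hf
    have hlog : 0 < Real.log n := Real.log_pos (by exact_mod_cast (by omega : 1 < n))
    -- One instance suffices. The value of `ε` cancels from the ratio, so `1 / 20` and `k = 1` are
    -- arbitrary admissible choices.
    have hopt := NoisyTopK.gapInstance_rMinOpt_le (n := n) (k := 1) (by omega) (by omega) (1 / 20)
      (by norm_num) (by norm_num)
    have hcount := hA.le_rMin_gapInstance hn le_rfl (by omega) (1 / 20) (by norm_num)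
      (by norm_num) (by norm_num)
    have h := (hcount.trans (hf _)).trans (mul_le_mul_right hopt _)
    rw [← ENNReal.ofReal_coe_nnreal, ← ENNReal.ofReal_mul f.coe_nonneg,
      ENNReal.ofReal_le_ofReal_iff (by positivity)] at h
    rw [div_le_iff₀ hlog]
    have e : (f : ℝ) * (3 * Real.log n / (1 / 20) ^ 2) = 1200 * (f * Real.log n) := by ring
    have e' : 1 / 512 * (n : ℝ) / (1 / 20) ^ 2 = 1200 * (1 / 1536 * n) := by ring
    rw [e, e'] at h
    linarith
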